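/- Let $A$ be an idiom, i.e. a complete lattice (with bottom $0$ and top $1$) that is modular and satisfies $a\wedge\bigvee X=\bigvee\{a\wedge x\mid x\in X\}$ for every $a\in A$ and every directed $X\subseteq A$. A nucleus on $A$ is a map $j\colon A\to A$ with $x\le j(x)$, $j(j(x))=j(x)$ and $j(x\wedge y)=j(x)\wedge j(y)$ for all $x,y\in A$. Ordered pointwise, the nuclei on $A$ form a frame $N(A)$, whose top $tp$ is the constant map with value $1$ and whose bottom is the identity; $\neg j$ denotes the pseudocomplement of $j$ in $N(A)$. An interval is $[a,b]=\{x\in A\mid a\le x\le b\}$ with $a\le b$ in $A$. Two intervals are similar if, for some $l,r\in A$, one is $[l,l\vee r]$ and the other is $[l\wedge r,r]$. A division set is a non-empty set $\mathcal D$ of intervals that is closed under similarity and under subintervals, such that $[a,b],[b,c]\in\mathcal D$ implies $[a,c]\in\mathcal D$, and such that $[a,\bigvee X]\in\mathcal D$ whenever $\emptyset\ne X\subseteq[a,1]$ and $[a,x]\in\mathcal D$ for all $x\in X$. For a nucleus $j$ let $\mathcal D_j=\{[a,b]\mid j(a)=j(b)\}$, and let $\mathcal F_j$ be the set of all intervals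 $[a,b]$ such that for every $a\le x\le b$ there is $a\le y\le b$ with $x\wedge y=a$ and $[x\vee y,b]\in\mathcal D_j$. Let $\mathcal E_j$ be the least division set containing $\mathcal F_j$. The Boyle derivative of $j$ is the nucleus $Boy(j)$ given by $Boy(j)(a)=\bigvee\{x\ge a\mid [a,x]\in\mathcal E_j\}$. A nucleus $j$ is spectral if the lattice $A_j=\{a\in A\mid j(a)=a\}$ (with the order of $A$) is complemented. Theorem. Let $j$ be a nucleus on the idiom $A$. (1) If $Boy(j)=tp$, then $\neg j\vee\neg\neg j=tp$ in $N(A)$. (2) If $j$ is spectral, then $\neg j\vee\neg\neg j=tp$ in $N(A)$. -/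

import Mathlib

/-- An idiom: a complete lattice that is modular and upper-continuous. -/
class IsIdiom (A : Type*) [CompleteLattice A] : Prop extends IsModularLattice A where
  inf_sSup_of_directed : ∀ (a : A) (X : Set A), DirectedOn (· ≤ ·) X →
    a ⊓ sSup X = sSup ((fun x => a ⊓ x) '' X)

namespace IsIdiom

/-! ### The assembly is a frame -/

section Assembly

variable {A : Type*} [CompleteLattice A]

/-- If `x ⊓ b ≤ z` then `x` can be enlarged, keeping this inequality, to an element fixed by all
nuclei in a set `S` that fix `z`. -/
theorem exists_fixed [IsIdiom A] (S : Set (Nucleus A)) {b z : A} (hz : ∀ j ∈ S, j z = z)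
    {a : A} (ha : a ⊓ b ≤ z) : ∃ x, a ≤ x ∧ x ⊓ b ≤ z ∧ ∀ j ∈ S, j x = x := by
  obtain ⟨m, ham, hm⟩ := zorn_le_nonempty₀ {x : A | x ⊓ b ≤ z} (by
    intro c hc hchain y hy
    refine ⟨sSup c, ?_, fun w hw => le_sSup hw⟩
    have h := inf_sSup_of_directed b c hchain.directedOn
    change sSup c ⊓ b ≤ z
    rw [inf_comm, h]
    apply sSup_le
    rintro _ ⟨w, hw, rfl⟩
    have := hc hw
    change b ⊓ w ≤ z
    rw [inf_comm]
    exact this) a ha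
  refine ⟨m, ham, hm.prop, fun j hj => le_antisymm ?_ j.le_apply⟩
  refine hm.le_of_ge ?_ j.le_apply
  have hmb : m ⊓ b ≤ z := hm.prop
  calc j m ⊓ b ≤ j m ⊓ j b := inf_le_inf_left _ j.le_apply
    _ = j (m ⊓ b) := j.map_inf.symm
    _ ≤ j z := j.monotone hmb
    _ = z := hz j hj

/-- The nucleus whose fixed elements are the common fixed elements of a set of nuclei. -/
def commonFixed [IsIdiom A] (S : Set (Nucleus A)) : Nucleus A where
  toFun a := sInf {y | a ≤ y ∧ ∀ j ∈ S, j y = y}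
  map_inf' a b := by
    have key : ∀ {a b z : A}, (∀ j ∈ S, j z = z) → a ⊓ b ≤ z →
        sInf {y | a ≤ y ∧ ∀ j ∈ S, j y = y} ⊓ b ≤ z := by
      intro a b z hz hab
      obtain ⟨x, hax, hxb, hx⟩ := exists_fixed S hz hab
      have hle : sInf {y | a ≤ y ∧ ∀ j ∈ S, j y = y} ≤ x := sInf_le ⟨hax, hx⟩
      exact (inf_le_inf_right b hle).trans hxb
    apply le_antisymm
    · apply le_inf
      · exact sInf_le_sInf fun y hy => ⟨inf_le_left.trans hy.1, hy.2⟩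
      · exact sInf_le_sInf fun y hy => ⟨inf_le_right.trans hy.1, hy.2⟩
    · refine le_sInf ?_
      rintro z ⟨habz, hz⟩
      have h1 := key hz habz
      rw [inf_comm] at h1
      have h2 := key hz h1
      rw [inf_comm] at h2
      exact h2
  idempotent' a := by
    exact le_sInf fun y hy => sInf_le (And.intro (sInf_le hy) hy.2)
  le_apply' a := le_sInf fun y hy => hy.1

theorem sSup_apply_of_fixed [IsIdiom A] {S : Set (Nucleus A)} {x : A} (hx : ∀ j ∈ S, j x = x) :
    (sSup S) x = x := by
  refine le_antisymm ?_ (sSup S).le_apply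
  have hle : sSup S ≤ commonFixed S := sSup_le fun j hj a => le_sInf fun y hy =>
    (j.monotone hy.1).trans (hy.2 j hj).le
  refine (hle x).trans ?_
  exact sInf_le ⟨le_rfl, hx⟩

/-- The assembly `N(A)` of all nuclei on an idiom `A`, with the pointwise order, is a frame.
Its complete lattice structure is that of `Nucleus A`; `k ≤ (j ⇨ l) ↔ k ⊓ j ≤ l` and
`jᶜ = j ⇨ ⊥` is the negation of `j`. -/
instance assemblyFrame [IsIdiom A] : Order.Frame (Nucleus A) :=
  Order.Frame.ofMinimalAxioms
    { inf_sSup_le_iSup_inf := by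
        intro k S a
        set m : Nucleus A := ⨆ j ∈ S, k ⊓ j with hm
        have hle : ∀ j ∈ S, ∀ y, k y ⊓ j y ≤ m y := fun j hj y =>
          (le_iSup₂ (f := fun (j : Nucleus A) (_ : j ∈ S) => k ⊓ j) j hj : k ⊓ j ≤ m) y
        change k a ⊓ (sSup S) a ≤ m a
        obtain ⟨x, hax, hxk, hx⟩ : ∃ x, a ≤ x ∧ x ⊓ k (m a) ≤ m a ∧ ∀ j ∈ S, j x = x := by
          obtain ⟨x, hax, hx⟩ := zorn_le_nonempty₀ {x : A | x ⊓ k (m a) ≤ m a} (by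
            intro c hc hchain y hy
            refine ⟨sSup c, ?_, fun w hw => le_sSup hw⟩
            have h := inf_sSup_of_directed (k (m a)) c hchain.directedOn
            change sSup c ⊓ k (m a) ≤ m a
            rw [inf_comm, h]
            apply sSup_le
            rintro _ ⟨w, hw, rfl⟩
            have := hc hw
            change k (m a) ⊓ w ≤ m a
            rw [inf_comm]
            exact this) a (inf_le_left.trans m.le_apply)
          have hxm : x ⊓ k (m a) ≤ m a := hx.prop
          refine ⟨x, hax, hxm, fun j hj => le_antisymm ?_ j.le_apply⟩
          refine hx.le_of_ge ?_ j.le_apply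
          change j x ⊓ k (m a) ≤ m a
          have h1 : j x ⊓ k (m a) ≤ j (m a) := by
            calc j x ⊓ k (m a) ≤ j x ⊓ j (k (m a)) := inf_le_inf_left _ j.le_apply
              _ = j (x ⊓ k (m a)) := j.map_inf.symm
              _ ≤ j (m a) := j.monotone hxm
          calc j x ⊓ k (m a) ≤ k (m a) ⊓ j (m a) := le_inf inf_le_right h1
            _ ≤ m (m a) := hle j hj _
            _ = m a := m.idempotent a
        have h2 : (sSup S) a ≤ x := ((sSup S).monotone hax).trans (sSup_apply_of_fixed hx).le
        calc k a ⊓ (sSup S) a ≤ k (m a) ⊓ x := inf_le_inf (k.monotone m.le_apply) h2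
          _ = x ⊓ k (m a) := inf_comm _ _
          _ ≤ m a := hxk }

end Assembly

/-! ### Sets of intervals -/

section Intervals

variable {A : Type*} [CompleteLattice A]

/-- The interval `[a, b]`. -/
abbrev iv (a b : A) (h : a ≤ b) : NonemptyInterval A := ⟨(a, b), h⟩

/-- Similarity of intervals: one is `[l, l ⊔ r]` and the other is `[l ⊓ r, r]`. -/
def Similar (J I : NonemptyInterval A) : Prop :=
  ∃ l r : A,
    (J = iv l (l ⊔ r) le_sup_left ∧ I = iv (l ⊓ r) r inf_le_right) ∨
    (J = iv (l ⊓ r) r inf_le_right ∧ I = iv l (l ⊔ r) le_sup_left)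

/-- A nonempty set of intervals closed under similarity. -/
structure IsAbstract (B : Set (NonemptyInterval A)) : Prop where
  nonempty : B.Nonempty
  similar : ∀ J I, Similar J I → I ∈ B → J ∈ B

/-- An abstract set closed under subintervals. -/
structure IsBasic (B : Set (NonemptyInterval A)) : Prop extends IsAbstract B where
  subinterval : ∀ J I, J ≤ I → I ∈ B → J ∈ B

/-- A basic set closed under abutting intervals. -/
structure IsCongruence (B : Set (NonemptyInterval A)) : Prop extends IsBasic B where
  abut : ∀ (a b c : A) (hab : a ≤ b) (hbc : b ≤ c),
    iv a b hab ∈ B → iv b c hbc ∈ B → iv a c (hab.trans hbc) ∈ B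

/-- A congruence set closed under suprema of intervals with a common lower end
(the empty supremum, taken in `[a, ⊤]`, yields `[a, a]`, which lies in every basic set). -/
structure IsDivision (B : Set (NonemptyInterval A)) : Prop extends IsCongruence B where
  sup : ∀ (a : A) (X : Set A), X.Nonempty → (∀ x ∈ X, ∃ h : a ≤ x, iv a x h ∈ B) →
    ∃ h : a ≤ sSup X, iv a (sSup X) h ∈ B

/-- `Dvs B`: the least division set containing `B`. -/
def Dvs (B : Set (NonemptyInterval A)) : Set (NonemptyInterval A) :=
  ⋂₀ {D | IsDivision D ∧ B ⊆ D}

/-- `Fll B`: the `B`-full intervals `[a, b]`: for all `a ≤ x ≤ b` there is `a ≤ y ≤ b` with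
`a = x ⊓ y` and `[x ⊔ y, b] ∈ B`. -/
def Fll (B : Set (NonemptyInterval A)) : Set (NonemptyInterval A) :=
  {I | ∀ x, I.fst ≤ x → x ≤ I.snd → ∃ y, I.fst ≤ y ∧ y ≤ I.snd ∧ I.fst = x ⊓ y ∧
    ∃ h : x ⊔ y ≤ I.snd, iv (x ⊔ y) I.snd h ∈ B}

/-- The division set `D_j` of a nucleus `j`: the intervals `[a, b]` with `j a = j b`. -/
def nucleusSet (j : Nucleus A) : Set (NonemptyInterval A) :=
  {I | j I.fst = j I.snd}

/-- The associated inflator `|B|` of a set of intervals. -/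
def assoc (B : Set (NonemptyInterval A)) (a : A) : A :=
  sSup {x | ∃ h : a ≤ x, iv a x h ∈ B}

theorem mem_of_eq {B : Set (NonemptyInterval A)} {a b a' b' : A} {h : a ≤ b}
    (hI : iv a b h ∈ B) (ha : a = a') (hb : b = b') (h' : a' ≤ b') : iv a' b' h' ∈ B := by
  subst ha hb
  exact hI

theorem IsBasic.sub_mem {B : Set (NonemptyInterval A)} (hB : IsBasic B) {a b c d : A}
    {hab : a ≤ b} (h : iv a b hab ∈ B) (hac : a ≤ c) (hcd : c ≤ d) (hdb : d ≤ b) :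
    iv c d hcd ∈ B :=
  hB.subinterval (iv c d hcd) (iv a b hab) ⟨hac, hdb⟩ h

theorem IsBasic.trivial_mem {B : Set (NonemptyInterval A)} (hB : IsBasic B) (a : A) :
    iv a a le_rfl ∈ B := by
  obtain ⟨⟨⟨c, d⟩, hcd⟩, hI⟩ := hB.nonempty
  have h1 : iv c c le_rfl ∈ B := hB.sub_mem (hab := hcd) hI le_rfl le_rfl hcd
  have h2 : iv (c ⊔ a) (c ⊔ a ⊔ c) le_sup_left ∈ B :=
    hB.similar _ _ ⟨c ⊔ a, c, Or.inl ⟨rfl, rfl⟩⟩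
      (mem_of_eq h1 (inf_eq_right.2 le_sup_left).symm rfl _)
  have h3 : iv ((c ⊔ a) ⊓ a) a inf_le_right ∈ B :=
    hB.similar _ _ ⟨c ⊔ a, a, Or.inr ⟨rfl, rfl⟩⟩
      (hB.sub_mem h2 le_rfl le_sup_left (sup_le le_sup_left (le_sup_right.trans le_sup_left)))
  exact mem_of_eq h3 (inf_eq_right.2 le_sup_right) rfl _

theorem isDivision_univ : IsDivision (Set.univ : Set (NonemptyInterval A)) where
  nonempty := ⟨iv ⊥ ⊥ le_rfl, trivial⟩
  similar _ _ _ _ := trivial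
  subinterval _ _ _ _ := trivial
  abut _ _ _ _ _ _ _ := trivial
  sup _ _ hX h := by
    obtain ⟨x, hx⟩ := hX
    exact ⟨(h x hx).1.trans (le_sSup hx), trivial⟩

theorem isDivision_Dvs (B : Set (NonemptyInterval A)) : IsDivision (Dvs B) where
  nonempty := ⟨iv ⊥ ⊥ le_rfl, fun _ hD => hD.1.toIsBasic.trivial_mem ⊥⟩
  similar J I h hI D hD := hD.1.similar J I h (hI D hD)
  subinterval J I h hI D hD := hD.1.subinterval J I h (hI D hD)
  abut a b c hab hbc h1 h2 D hD := hD.1.abut a b c hab hbc (h1 D hD) (h2 D hD)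
  sup a X hX h := by
    obtain ⟨x, hx⟩ := hX
    refine ⟨(h x hx).1.trans (le_sSup hx), fun D hD => ?_⟩
    exact (hD.1.sup a X ⟨x, hx⟩ fun y hy => ⟨(h y hy).1, (h y hy).2 D hD⟩).2

theorem subset_Dvs (B : Set (NonemptyInterval A)) : B ⊆ Dvs B :=
  fun _ hI _ hD => hD.2 hI

theorem IsDivision.assoc_mem {D : Set (NonemptyInterval A)} (hD : IsDivision D) (a : A) :
    ∃ h : a ≤ assoc D a, iv a (assoc D a) h ∈ D :=
  hD.sup a _ ⟨a, le_rfl, hD.toIsBasic.trivial_mem a⟩ fun _ hx => hx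

theorem IsDivision.shift {D : Set (NonemptyInterval A)} (hD : IsDivision D) {a b c : A}
    (hab : a ≤ b) (h : iv a b hab ∈ D) (hcb : c ≤ b) : iv (a ⊓ c) c inf_le_right ∈ D :=
  hD.similar _ _ ⟨a, c, Or.inr ⟨rfl, rfl⟩⟩
    (hD.toIsBasic.sub_mem h le_rfl le_sup_left (sup_le hab hcb))

theorem IsDivision.assoc_mono {D : Set (NonemptyInterval A)} (hD : IsDivision D) {a b : A}
    (hab : a ≤ b) : assoc D a ≤ assoc D b := by
  refine sSup_le ?_
  rintro x ⟨hax, hx⟩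
  have h1 : iv (b ⊓ x) x inf_le_right ∈ D :=
    hD.toIsBasic.sub_mem hx (le_inf hab hax) inf_le_right le_rfl
  have h2 : iv b (b ⊔ x) le_sup_left ∈ D := hD.similar _ _ ⟨b, x, Or.inl ⟨rfl, rfl⟩⟩ h1
  exact le_sup_right.trans (le_sSup ⟨le_sup_left, h2⟩)

/-- The nucleus associated with a division set. -/
def IsDivision.toNucleus {D : Set (NonemptyInterval A)} (hD : IsDivision D) : Nucleus A where
  toFun := assoc D
  map_inf' a b := by
    apply le_antisymm (le_inf (hD.assoc_mono inf_le_left) (hD.assoc_mono inf_le_right))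
    obtain ⟨ha, hda⟩ := hD.assoc_mem a
    obtain ⟨hb, hdb⟩ := hD.assoc_mem b
    have h1 := hD.shift ha hda (c := assoc D a ⊓ b) inf_le_left
    have h2 := hD.shift hb hdb (c := assoc D a ⊓ assoc D b) inf_le_right
    have e1 : a ⊓ (assoc D a ⊓ b) = a ⊓ b := by rw [← inf_assoc, inf_eq_left.2 ha]
    have e2 : b ⊓ (assoc D a ⊓ assoc D b) = assoc D a ⊓ b := by
      rw [inf_left_comm, inf_eq_left.2 hb]
    have h1' : iv (a ⊓ b) (assoc D a ⊓ b) (inf_le_inf_right _ ha) ∈ D :=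
      mem_of_eq h1 e1 rfl _
    have h2' : iv (assoc D a ⊓ b) (assoc D a ⊓ assoc D b) (inf_le_inf_left _ hb) ∈ D :=
      mem_of_eq h2 e2 rfl _
    exact le_sSup ⟨_, hD.abut _ _ _ _ _ h1' h2'⟩
  idempotent' a := by
    obtain ⟨ha, hda⟩ := hD.assoc_mem a
    obtain ⟨hb, hdb⟩ := hD.assoc_mem (assoc D a)
    exact le_sSup ⟨_, hD.abut _ _ _ _ _ hda hdb⟩
  le_apply' a := (hD.assoc_mem a).1

/-- The Boyle derivative: `Boy j` is the nucleus associated with the division set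
`Dvs (Fll D_j)`. -/
def Boy (j : Nucleus A) : Nucleus A := (isDivision_Dvs (Fll (nucleusSet j))).toNucleus

end Intervals

/-! ### The quotient of a nucleus -/

section Quotient

variable {A : Type*} [CompleteLattice A]

/-- `A_j`: the set of elements fixed by `j`, with the order of `A`. -/
abbrev Fixed (j : Nucleus A) : Type _ := {a : A // j a = a}

/-- `A_j` is a complete lattice; suprema are the values of `j` at the suprema of `A`. -/
instance (j : Nucleus A) : CompleteLattice (Fixed j) :=
  (j.toClosureOperator.gi).liftCompleteLattice

theorem Fixed.coe_inf (j : Nucleus A) (x y : Fixed j) : ((x ⊓ y : Fixed j) : A) = x ⊓ y := rfl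

theorem Fixed.coe_sup (j : Nucleus A) (x y : Fixed j) : ((x ⊔ y : Fixed j) : A) = j (x ⊔ y) := rfl

theorem Fixed.coe_bot (j : Nucleus A) : ((⊥ : Fixed j) : A) = j ⊥ := rfl

theorem Fixed.coe_top (j : Nucleus A) : ((⊤ : Fixed j) : A) = ⊤ := rfl

/-- A nucleus `j` is spectral if `A_j` is a complemented lattice. -/
def IsSpectral (j : Nucleus A) : Prop := ComplementedLattice (Fixed j)

end Quotient

end IsIdiom

namespace IsIdiom

/-! ### Nuclei, pseudocomplements and intervals -/

section NucleusIntervals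

variable {A : Type*} [CompleteLattice A]

/-! Everything rests on `Boy j ≤ jᶜ ⊔ jᶜᶜ`, from which (1) is immediate. Put `m = jᶜ ⊔ jᶜᶜ`. Since
`nucleusSet m` is a division set, it is enough that it contains every full interval
(`Fll_nucleusSet_subset`). Cutting `[a, b]` down to `[m a ⊓ b, b]` keeps it full, and there neither
`jᶜ` nor `jᶜᶜ` moves the lower end within `b`; `le_of_full_of_inf_compl_le` shows that such an
interval is trivial, so `b ≤ m a`. The link from intervals to pseudocomplements is the division set
`negSet k`, whose nucleus lies below `kᶜ`. For (2), spectrality makes `[j ⊥, ⊤]` full; abutting it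
with `[⊥, j ⊥]` gives `Boy j = ⊤`. -/

theorem iv_mem_nucleusSet {j : Nucleus A} {a b : A} (h : a ≤ b) :
    iv a b h ∈ nucleusSet j ↔ b ≤ j a := by
  change j a = j b ↔ _
  refine ⟨fun e => e ▸ j.le_apply, fun hb => le_antisymm (j.monotone h) ?_⟩
  exact (j.monotone hb).trans (j.idempotent a).le

theorem isDivision_nucleusSet (j : Nucleus A) : IsDivision (nucleusSet j) where
  nonempty := ⟨iv ⊥ ⊥ le_rfl, rfl⟩
  similar := by
    rintro _ _ ⟨l, r, ⟨rfl, rfl⟩ | ⟨rfl, rfl⟩⟩ h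
    · rw [iv_mem_nucleusSet] at h ⊢
      exact sup_le j.le_apply (h.trans (j.monotone inf_le_left))
    · rw [iv_mem_nucleusSet] at h ⊢
      rw [j.map_inf]
      exact le_inf (le_sup_right.trans h) j.le_apply
  subinterval := by
    rintro ⟨⟨c, d⟩, hcd⟩ ⟨⟨a, b⟩, hab⟩ ⟨hac, hdb⟩ h
    exact (iv_mem_nucleusSet hcd).2
      (hdb.trans (((iv_mem_nucleusSet hab).1 h).trans (j.monotone hac)))
  abut _ _ _ _ _ h₁ h₂ := Eq.trans h₁ h₂
  sup a X hX h := by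
    obtain ⟨x, hx⟩ := hX
    refine ⟨(h x hx).1.trans (le_sSup hx), ?_⟩
    rw [iv_mem_nucleusSet]
    exact sSup_le fun y hy => (iv_mem_nucleusSet (h y hy).1).1 (h y hy).2

/-- The intervals without nontrivial subintervals in `nucleusSet k`. -/
def negSet (k : Nucleus A) : Set (NonemptyInterval A) :=
  {I | ∀ x y, I.fst ≤ x → x ≤ y → y ≤ I.snd → y ≤ k x → y ≤ x}

/-- Meeting with `r` moves a subinterval down without leaving `nucleusSet k`; modularity recovers
`y` as `l ⊔ r ⊓ y`. -/
theorem negSet_sup_mem [IsIdiom A] {k : Nucleus A} {l r : A}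
    (h : iv (l ⊓ r) r inf_le_right ∈ negSet k) : iv l (l ⊔ r) le_sup_left ∈ negSet k := by
  intro x y hlx hxy hy hk
  change l ≤ x at hlx
  change y ≤ l ⊔ r at hy
  have hyr : y ⊓ r ≤ x ⊓ r := by
    refine h _ _ (inf_le_inf_right r hlx) (inf_le_inf_right r hxy) inf_le_right ?_
    rw [k.map_inf]
    exact inf_le_inf hk k.le_apply
  calc y = (l ⊔ r) ⊓ y := (inf_eq_right.2 hy).symm
    _ = l ⊔ r ⊓ y := sup_inf_assoc_of_le r (hlx.trans hxy)
    _ ≤ x := sup_le hlx (by rw [inf_comm]; exact hyr.trans inf_le_left)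

theorem negSet_inf_mem [IsIdiom A] {k : Nucleus A} {l r : A}
    (h : iv l (l ⊔ r) le_sup_left ∈ negSet k) : iv (l ⊓ r) r inf_le_right ∈ negSet k := by
  intro x y hlx hxy hy hk
  change l ⊓ r ≤ x at hlx
  change y ≤ r at hy
  have hly : l ⊔ y ≤ l ⊔ x := by
    refine h _ _ le_sup_left (sup_le_sup_left hxy l) (sup_le_sup_left hy l) ?_
    exact sup_le (le_sup_left.trans k.le_apply) (hk.trans (k.monotone le_sup_right))
  calc y ≤ (x ⊔ l) ⊓ r := le_inf (le_sup_right.trans (hly.trans (sup_comm l x).le)) hy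
    _ = x ⊔ l ⊓ r := sup_inf_assoc_of_le l (hxy.trans hy)
    _ ≤ x := sup_le le_rfl hlx

/-- A subinterval collapses after meeting with `b` and after joining with `b`, so modular
cancellation collapses it. -/
theorem negSet_abut [IsIdiom A] {k : Nucleus A} {a b c : A} (hab : a ≤ b) (hbc : b ≤ c)
    (h₁ : iv a b hab ∈ negSet k) (h₂ : iv b c hbc ∈ negSet k) :
    iv a c (hab.trans hbc) ∈ negSet k := by
  intro x y hax hxy hyc hk
  have hinf : y ⊓ b ≤ x ⊓ b := by
    refine h₁ _ _ (le_inf hax hab) (inf_le_inf_right b hxy) inf_le_right ?_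
    rw [k.map_inf]
    exact inf_le_inf hk k.le_apply
  have hsup : y ⊔ b ≤ x ⊔ b := by
    refine h₂ _ _ le_sup_right (sup_le_sup_right hxy b) (sup_le hyc hbc) ?_
    exact sup_le (hk.trans (k.monotone le_sup_left)) (le_sup_right.trans k.le_apply)
  exact (eq_of_le_of_inf_le_of_sup_le hxy hinf hsup).ge

/-- In an upper-continuous lattice, intervals with a common lower end in `negSet k` have their
directed supremum in `negSet k`. -/
theorem negSet_sSup_of_directed [IsIdiom A] {k : Nucleus A} {a : A} {X : Set A}
    (hX : DirectedOn (· ≤ ·) X) (h : ∀ x ∈ X, ∃ h : a ≤ x, iv a x h ∈ negSet k)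
    (ha : a ≤ sSup X) : iv a (sSup X) ha ∈ negSet k := by
  intro x y hax hxy hy hk
  change y ≤ sSup X at hy
  rw [← inf_eq_left.2 hy, inf_sSup_of_directed y X hX]
  refine sSup_le ?_
  rintro _ ⟨z, hz, rfl⟩
  obtain ⟨haz, hz⟩ := h z hz
  refine le_trans (hz (x ⊓ z) (y ⊓ z) (le_inf hax haz) (inf_le_inf_right z hxy)
    inf_le_right ?_) inf_le_left
  rw [k.map_inf]
  exact inf_le_inf hk k.le_apply

theorem isDivision_negSet [IsIdiom A] (k : Nucleus A) : IsDivision (negSet k) where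
  nonempty := ⟨iv ⊥ ⊥ le_rfl, fun _ _ _ _ hy _ => hy.trans bot_le⟩
  similar := by
    rintro _ _ ⟨l, r, ⟨rfl, rfl⟩ | ⟨rfl, rfl⟩⟩ h
    · exact negSet_sup_mem h
    · exact negSet_inf_mem h
  subinterval := by
    rintro ⟨⟨c, d⟩, hcd⟩ ⟨⟨a, b⟩, hab⟩ ⟨hac, hdb⟩ h x y hx hxy hy
    exact h x y (le_trans hac hx) hxy (le_trans hy hdb)
  abut _ _ _ hab hbc h₁ h₂ := negSet_abut hab hbc h₁ h₂
  sup a X hX h := by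
    -- `X` need not be directed, but the set of all admissible upper ends is, by similarity and
    -- abutting.
    let Y : Set A := {x | ∃ h : a ≤ x, iv a x h ∈ negSet k}
    have hY : DirectedOn (· ≤ ·) Y := by
      rintro x ⟨hax, hx⟩ y ⟨hay, hy⟩
      refine ⟨x ⊔ y, ⟨hax.trans le_sup_left, ?_⟩, le_sup_left, le_sup_right⟩
      refine negSet_abut hax le_sup_left hx (negSet_sup_mem ?_)
      exact fun u v hu huv hv => hy u v ((le_inf hax hay).trans hu) huv hv
    have hXY : sSup X ≤ sSup Y := sSup_le_sSup h
    obtain ⟨x, hx⟩ := hX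
    have haX : a ≤ sSup X := (h x hx).1.trans (le_sSup hx)
    have hmem := negSet_sSup_of_directed hY (fun _ hx => hx) (haX.trans hXY)
    exact ⟨haX, fun u v hu huv hv => hmem u v hu huv (le_trans hv hXY)⟩

/-- The interval from `a` to `assoc (negSet k) a ⊓ k a` lies in `nucleusSet k` and inside a member
of `negSet k`, hence is trivial. -/
theorem toNucleus_negSet_le_compl [IsIdiom A] (k : Nucleus A) :
    (isDivision_negSet k).toNucleus ≤ kᶜ := by
  rw [le_compl_iff_disjoint_right, disjoint_iff_inf_le]
  intro a
  change assoc (negSet k) a ⊓ k a ≤ a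
  obtain ⟨ha, hmem⟩ := (isDivision_negSet k).assoc_mem a
  exact hmem a _ le_rfl (le_inf ha k.le_apply) inf_le_left inf_le_right

theorem le_compl_apply_of_mem_negSet [IsIdiom A] {k : Nucleus A} {a b : A} {h : a ≤ b}
    (hI : iv a b h ∈ negSet k) : b ≤ kᶜ a :=
  (show b ≤ assoc (negSet k) a from le_sSup ⟨h, hI⟩).trans (toNucleus_negSet_le_compl k a)

theorem apply_inf_compl_apply_le [IsIdiom A] (k : Nucleus A) (a : A) : k a ⊓ kᶜ a ≤ a :=
  (inf_compl_self k).le a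

end NucleusIntervals

/-! ### Full intervals and the Boyle derivative -/

section Full

variable {A : Type*} [CompleteLattice A]

theorem nucleusSet_subset_Fll (j : Nucleus A) : nucleusSet j ⊆ Fll (nucleusSet j) := by
  rintro ⟨⟨a, b⟩, hab⟩ h x hax hxb
  change a ≤ x at hax
  change x ≤ b at hxb
  refine ⟨a, le_rfl, hab, (inf_eq_right.2 hax).symm, sup_le hxb hab, ?_⟩
  rw [iv_mem_nucleusSet]
  exact ((iv_mem_nucleusSet hab).1 h).trans (j.monotone le_sup_right)

/-- A full interval `[e, b]` in which `jᶜ` and `jᶜᶜ` both fix `e` is trivial. -/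
theorem le_of_full_of_inf_compl_le [IsIdiom A] {j : Nucleus A} {e b : A}
    (hfull : ∀ x, e ≤ x → x ≤ b → ∃ y, e ≤ y ∧ y ≤ b ∧ x ⊓ y = e ∧ b ≤ j (x ⊔ y))
    (h₁ : jᶜ e ⊓ b ≤ e) (h₂ : jᶜᶜ e ⊓ b ≤ e) (heb : e ≤ b) : b ≤ e := by
  suffices hmem : iv e b heb ∈ negSet jᶜ from
    (le_inf (le_compl_apply_of_mem_negSet hmem) le_rfl).trans h₂
  intro u v heu huv hvb hv
  change e ≤ u at heu
  change v ≤ b at hvb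
  -- Enlarging `u` to its `j`-closure within `b` costs nothing, as only `v ≤ j u` is needed at the
  -- end.
  set x := j u ⊓ b
  have hux : u ≤ x := le_inf j.le_apply (huv.trans hvb)
  obtain ⟨w, hew, hwb, hxw, hjw⟩ := hfull x (heu.trans hux) inf_le_right
  -- By modularity `t = x ⊔ w ⊓ t`, so `[x, t]` is similar to `[e, w ⊓ t]`. The former is collapsed
  -- by `jᶜ`, hence so is the latter, and `h₁` makes both trivial.
  set t := (x ⊔ w) ⊓ (x ⊔ v)
  have hxt : x ≤ t := le_inf le_sup_left le_sup_left
  have hxs : x ⊔ w ⊓ t = t := by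
    rw [← sup_inf_assoc_of_le w hxt]
    exact inf_eq_right.2 inf_le_left
  have htx : t ≤ jᶜ x := inf_le_right.trans
    (sup_le (jᶜ).le_apply (hv.trans ((jᶜ).monotone hux)))
  have hs : w ⊓ t ≤ jᶜ e := by
    have : w ⊓ t ≤ jᶜ (x ⊓ w) := by
      rw [(jᶜ).map_inf]
      exact le_inf (inf_le_right.trans htx) (inf_le_left.trans (jᶜ).le_apply)
    rwa [hxw] at this
  have hse : w ⊓ t ≤ e := (le_inf hs (inf_le_left.trans hwb)).trans h₁
  have htle : t ≤ x := hxs.ge.trans (sup_le le_rfl (hse.trans (heu.trans hux)))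
  have hvu : v ≤ j u := calc
    v ≤ j (x ⊔ w) ⊓ j (x ⊔ v) :=
      le_inf (hvb.trans hjw) (le_sup_right.trans j.le_apply)
    _ = j t := j.map_inf.symm
    _ ≤ j (j u) := j.monotone (htle.trans inf_le_left)
    _ = j u := j.idempotent u
  exact (le_inf hvu hv).trans (apply_inf_compl_apply_le j u)

theorem Fll_nucleusSet_subset [IsIdiom A] (j : Nucleus A) :
    Fll (nucleusSet j) ⊆ nucleusSet (jᶜ ⊔ jᶜᶜ) := by
  rintro ⟨⟨a, b⟩, hab⟩ h
  change a ≤ b at hab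
  set m := jᶜ ⊔ jᶜᶜ
  rw [iv_mem_nucleusSet]
  have hcollapse : ∀ n ≤ m, n (m a ⊓ b) ⊓ b ≤ m a ⊓ b := fun n hn =>
    le_inf (inf_le_left.trans ((hn _).trans
      ((m.monotone inf_le_left).trans (m.idempotent a).le))) inf_le_right
  refine (le_of_full_of_inf_compl_le (j := j) (e := m a ⊓ b) ?_ (hcollapse _ le_sup_left)
    (hcollapse _ le_sup_right) inf_le_right).trans inf_le_left
  intro x hex hxb
  obtain ⟨y, -, hyb, hxy, hle, hj⟩ := h x ((le_inf m.le_apply hab).trans hex) hxb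
  change a = x ⊓ y at hxy
  -- With `e = m a ⊓ b ≤ x`, modularity gives `x ⊓ (e ⊔ y) = e ⊔ x ⊓ y = e ⊔ a = e`.
  refine ⟨m a ⊓ b ⊔ y, le_sup_left, sup_le inf_le_right hyb, ?_, ?_⟩
  · rw [inf_comm, sup_inf_assoc_of_le y hex, inf_comm y x, ← hxy]
    exact sup_eq_left.2 (le_inf m.le_apply hab)
  · exact ((iv_mem_nucleusSet hle).1 hj).trans
      (j.monotone (sup_le_sup_left le_sup_right x))

theorem Boy_le_compl_sup_compl_compl [IsIdiom A] (j : Nucleus A) : Boy j ≤ jᶜ ⊔ jᶜᶜ := by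
  intro a
  refine sSup_le ?_
  rintro x ⟨hax, hx⟩
  exact (iv_mem_nucleusSet hax).1
    (hx _ ⟨isDivision_nucleusSet _, Fll_nucleusSet_subset j⟩)

theorem IsSpectral.iv_mem_Fll {j : Nucleus A} (hj : IsSpectral j) :
    iv (j ⊥) ⊤ le_top ∈ Fll (nucleusSet j) := by
  intro x hx _
  change j ⊥ ≤ x at hx
  have : ComplementedLattice (Fixed j) := hj
  -- A complement of `j x` in `A_j` also serves for `x`: the meet only shrinks, and `j (x ⊔ c) = j
  -- (j x ⊔ c)`.
  obtain ⟨c, hc⟩ := exists_isCompl (⟨j x, j.idempotent x⟩ : Fixed j)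
  have hinf : j x ⊓ c = j ⊥ := congrArg Subtype.val hc.inf_eq_bot
  have hsup : j (j x ⊔ c) = ⊤ := congrArg Subtype.val hc.sup_eq_top
  have hbc : j ⊥ ≤ c := hinf.ge.trans inf_le_right
  refine ⟨c, hbc, le_top, le_antisymm (le_inf hx hbc) ?_, le_top, ?_⟩
  · exact (inf_le_inf_right _ j.le_apply).trans hinf.le
  · rw [iv_mem_nucleusSet]
    calc (⊤ : A) = j (j x ⊔ c) := hsup.symm
      _ ≤ j (j (x ⊔ c)) := j.monotone
        (sup_le (j.monotone le_sup_left) (le_sup_right.trans j.le_apply))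
      _ = j (x ⊔ c) := j.idempotent _

theorem IsSpectral.Boy_eq_top {j : Nucleus A} (hj : IsSpectral j) : Boy j = ⊤ := by
  have hmem : iv (⊥ : A) ⊤ bot_le ∈ Dvs (Fll (nucleusSet j)) :=
    (isDivision_Dvs _).abut ⊥ (j ⊥) ⊤ bot_le le_top
      (subset_Dvs _ (nucleusSet_subset_Fll j ((iv_mem_nucleusSet bot_le).2 le_rfl)))
      (subset_Dvs _ hj.iv_mem_Fll)
  refine top_unique fun a => ?_
  have ha : iv a ⊤ le_top ∈ Dvs (Fll (nucleusSet j)) :=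
    (isDivision_Dvs _).toIsBasic.sub_mem hmem bot_le le_top le_rfl
  exact le_top.trans (show (⊤ : A) ≤ Boy j a from le_sSup ⟨le_top, ha⟩)

end Full

end IsIdiom

theorem mainTheorem11 {A : Type*} [CompleteLattice A] [IsIdiom A] :
    (∀ j : Nucleus A, IsIdiom.Boy j = ⊤ → jᶜ ⊔ jᶜᶜ = ⊤) ∧
    (∀ j : Nucleus A, IsIdiom.IsSpectral j → jᶜ ⊔ jᶜᶜ = ⊤) := by
  have h : ∀ j : Nucleus A, IsIdiom.Boy j = ⊤ → jᶜ ⊔ jᶜᶜ = ⊤ := fun j hj =>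
    top_unique (hj.ge.trans (IsIdiom.Boy_le_compl_sup_compl_compl j))
  exact ⟨h, fun j hj => h j hj.Boy_eq_top⟩
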